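/- Let $B_n$ be the Coxeter group with generators $s_0,s_1,\dots,s_{n-1}$ and relations $s_i^2=1$, $(s_0s_1)^4=1$, $(s_is_{i+1})^3=1$ for $1\le i\le n-2$, and $(s_is_j)^2=1$ for $|i-j|\ge 2$; let $\ell$ be its Coxeter length. For $\pi\in B_n$ let $$des(\pi)=\{\,r : 0\le r\le n-1,\ \ell(s_r\cdot\pi)<\ell(\pi)\,\}$$ be the set of locations of the (left) descents of $\pi$. For $1\le k\le n$ put $\tau_k=s_0\cdot s_1\cdots s_{k-1}$, and let $\dot S_n$ be the parabolic subgroup of $B_n$ generated by $s_1,\dots,s_{n-1}$. Let $\pi\in\dot S_n$ be expressed by its generalized standard OGS presentation $$\pi=\tau_{k_1}^{i_{k_1}}\cdot\tau_{k_2}^{i_{k_2}}\cdots\tau_{k_m}^{i_{k_m}},\qquad 1\le k_1<k_2<\cdots<k_m\le n,\qquad -k_j\le i_{k_j}<k_j\ \ (1\le j\le m).$$ Then, for every $1\le j\le m$, $$k_j\in des(\pi)\iff i_{k_j}<0,$$ and these are all the descents of $\pi$, that is, $des(\pi)=\{k_j : 1\le j\le m,\ i_{k_j}<0\}$. -/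

import Mathlib

/-- The Coxeter matrix of type `B_n` on the indices `0, …, n - 1`, numbered so that the bond
of order `4` joins the indices `0` and `1` (Mathlib numbers the diagram from the other end). -/
def typeB (n : ℕ) : CoxeterMatrix (Fin n) :=
  (CoxeterMatrix.B n).reindex Fin.revPerm

/-- The entries of the matrix: the relations are `s_i ^ 2 = 1`, `(s_0 s_1) ^ 4 = 1`,
`(s_i s_{i+1}) ^ 3 = 1` for `1 ≤ i`, and `(s_i s_j) ^ 2 = 1` for `|i - j| ≥ 2`. -/
theorem typeB_apply (n : ℕ) (i j : Fin n) :
    typeB n i j =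
      if (i : ℕ) = j then 1
      else if ((i : ℕ) = 0 ∧ (j : ℕ) = 1) ∨ ((i : ℕ) = 1 ∧ (j : ℕ) = 0) then 4
      else if (i : ℕ) + 1 = j ∨ (j : ℕ) + 1 = i then 3
      else 2 := by
  have hi := i.isLt
  have hj := j.isLt
  simp only [typeB, CoxeterMatrix.reindex_apply, CoxeterMatrix.B, Fin.revPerm_symm,
    Fin.revPerm_apply, Matrix.of_apply, Fin.val_rev, Fin.ext_iff]
  split_ifs <;> first | rfl | omega

/-- The Coxeter group `B_n`, given by its Coxeter presentation. -/
abbrev BGroup (n : ℕ) : Type := (typeB n).Group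

/-- The Coxeter generator `s_i` of `B_n`, for `0 ≤ i ≤ n - 1`. -/
def sB (n : ℕ) (i : Fin n) : BGroup n := (typeB n).simple i

/-- The element `τ_k = s_0 s_1 ⋯ s_{k-1}` of `B_n`, for `k ≤ n`. -/
def tauB (n k : ℕ) (hk : k ≤ n) : BGroup n :=
  (List.ofFn fun j : Fin k => sB n (Fin.castLE hk j)).prod

/-- The parabolic subgroup of `B_n` generated by `s_1, …, s_{n-1}`. -/
def dotS (n : ℕ) : Subgroup (BGroup n) :=
  Subgroup.closure {g | ∃ i : Fin n, 1 ≤ (i : ℕ) ∧ g = sB n i}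

/-- The set of locations of the (left) descents of `w`: all `r` with `0 ≤ r ≤ n - 1` such that
`ℓ (s_r w) < ℓ w`, for the Coxeter length `ℓ` of `B_n`. -/
def desB (n : ℕ) (w : BGroup n) : Set ℕ :=
  {r | ∃ h : r < n,
    (typeB n).toCoxeterSystem.length (sB n ⟨r, h⟩ * w) < (typeB n).toCoxeterSystem.length w}

/-! With sign change `x ↦ 1 - x`, `τ_k` acts through `signedRep` as the cycle 1 → 2 → ⋯ → k → 0 → -1
→ ⋯ → 1-k → 1. On `dotS`, descents are inversions: `s_0` never shortens `w`, and for `r ≥ 1`, `s_r`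
does iff `w⁻¹(r+1) < w⁻¹(r)` (`mem_desB_iff`).

Prefixes of the product leave `dotS`, so the induction on the number of factors runs on a wider
statement, `foldRank_descent_iff`: if the positive integers with nonpositive image form a segment
{1, …, S}, then the inverse decreases, in the folded order 1 < ⋯ < K < 0 < -1 < ⋯, exactly at the
`k_j` with `i_j < 0`. Write the product as `u τ_k^i` with last factor `τ_k^i`; passing to `u` turns
S into S + i and K into k. The folded order for k follows the cycle, so `τ_k^(-i)` shifts ranks
without wrapping around and keeps every comparison at `r < k`. At `r = k`, `u⁻¹` fixes k and k+1,
and `τ_k^(-i)` moves k past k+1 in the folded order iff `i < 0`. Beyond k nothing moves. For `w` in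
`dotS`, S = 0 and all values are positive, so the folded order is the usual one. -/

/-! ### Signed permutations as a representation of `B_n` -/

/-- The permutation of `ℤ` swapping `i` with `i + 1` and `-i` with `1 - i`. Under the sign change
`x ↦ 1 - x` these generate the group of signed permutations. -/
def signedSwap (i : ℕ) : Equiv.Perm ℤ :=
  Function.Involutive.toPerm
    (fun x : ℤ => if x = i then (i : ℤ) + 1 else if x = i + 1 then (i : ℤ)
      else if x = -i then 1 - (i : ℤ) else if x = 1 - i then -(i : ℤ) else x)
    (by intro x; grind)

theorem signedSwap_apply (i : ℕ) (x : ℤ) :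
    signedSwap i x = if x = i then (i : ℤ) + 1 else if x = i + 1 then (i : ℤ)
      else if x = -i then 1 - (i : ℤ) else if x = 1 - i then -(i : ℤ) else x := rfl

theorem signedSwap_apply_up {i : ℕ} {x : ℤ} (h : x = i ∨ x = -i) :
    signedSwap i x = x + 1 := by
  rw [signedSwap_apply]; split_ifs <;> omega

theorem signedSwap_apply_down {i : ℕ} {x : ℤ} (h : x = i + 1 ∨ x = 1 - i) :
    signedSwap i x = x - 1 := by
  rw [signedSwap_apply]; split_ifs <;> omega

theorem signedSwap_apply_of_ne {i : ℕ} {x : ℤ}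
    (h : x ≠ i ∧ x ≠ i + 1 ∧ x ≠ -i ∧ x ≠ 1 - i) : signedSwap i x = x := by
  rw [signedSwap_apply]; split_ifs <;> omega

theorem signedSwap_one_sub (i : ℕ) (x : ℤ) :
    signedSwap i (1 - x) = 1 - signedSwap i x := by
  simp only [signedSwap_apply]; grind

theorem signedSwap_mul_self (i : ℕ) : signedSwap i * signedSwap i = 1 := by
  ext x; simp only [Equiv.Perm.mul_apply, Equiv.Perm.one_apply]; grind [signedSwap_apply]

theorem signedSwap_comm {i j : ℕ} (h : i + 2 ≤ j) :
    signedSwap i * signedSwap j = signedSwap j * signedSwap i := by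
  ext x
  simp only [Equiv.Perm.mul_apply]
  have hx : (x = i ∨ x = -i) ∨ (x = i + 1 ∨ x = 1 - i) ∨ (x = j ∨ x = -j) ∨
    (x = j + 1 ∨ x = 1 - j) ∨ (x ≠ i ∧ x ≠ i + 1 ∧ x ≠ -i ∧ x ≠ 1 - i ∧
      x ≠ j ∧ x ≠ j + 1 ∧ x ≠ -j ∧ x ≠ 1 - j) := by omega
  rcases hx with hx | hx | hx | hx | hx <;>
    simp (disch := omega) only [signedSwap_apply_up, signedSwap_apply_down, signedSwap_apply_of_ne]

theorem signedSwap_braid {i : ℕ} (h : 1 ≤ i) :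
    signedSwap i * signedSwap (i + 1) * signedSwap i =
      signedSwap (i + 1) * signedSwap i * signedSwap (i + 1) := by
  ext x
  simp only [Equiv.Perm.mul_apply]
  have hx : x = i ∨ x = i + 1 ∨ x = i + 2 ∨ x = 1 - i ∨ x = -i ∨ x = -i - 1 ∨
    (x ≠ i ∧ x ≠ i + 1 ∧ x ≠ i + 2 ∧ x ≠ 1 - i ∧ x ≠ -i ∧ x ≠ -i - 1) := by omega
  rcases hx with hx | hx | hx | hx | hx | hx | hx <;>
    simp (disch := (push_cast; omega)) only
      [signedSwap_apply_up, signedSwap_apply_down, signedSwap_apply_of_ne] <;> omega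

theorem signedSwap_zero_one : (signedSwap 0 * signedSwap 1) ^ 4 = 1 := by
  ext x
  simp only [pow_succ, pow_zero, one_mul, Equiv.Perm.mul_apply, Equiv.Perm.one_apply]
  have h (x) : signedSwap 0 (signedSwap 1 x) =
      if x = 1 then 2 else if x = 2 then 0 else if x = 0 then -1 else if x = -1 then 1 else x := by
    simp only [signedSwap_apply]; push_cast; grind
  have hx : x = 1 ∨ x = 2 ∨ x = 0 ∨ x = -1 ∨ (x ≠ 1 ∧ x ≠ 2 ∧ x ≠ 0 ∧ x ≠ -1) := by omega
  rcases hx with hx | hx | hx | hx | hx <;> simp [h, hx]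

/-- For involutions, `f j * f i` is the inverse of `f i * f j`, so one order of each pair suffices,
and commutation and braid identities replace the powers 2 and 3. -/
theorem typeB_isLiftable {n : ℕ} {G : Type*} [Group G] {f : Fin n → G}
    (hsq : ∀ i, f i * f i = 1)
    (hcomm : ∀ i j : Fin n, (i : ℕ) + 2 ≤ j → f i * f j = f j * f i)
    (hbraid : ∀ i j : Fin n, 1 ≤ (i : ℕ) → (i : ℕ) + 1 = j → f i * f j * f i = f j * f i * f j)
    (hfour : ∀ i j : Fin n, (i : ℕ) = 0 → (j : ℕ) = 1 → (f i * f j) ^ 4 = 1) :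
    (typeB n).IsLiftable f := by
  have hinv (i) : (f i)⁻¹ = f i := inv_eq_of_mul_eq_one_left (hsq i)
  have hflip (i j : Fin n) (m : ℕ) (h : (f i * f j) ^ m = 1) : (f j * f i) ^ m = 1 := by
    rw [← inv_inj, ← inv_pow, mul_inv_rev, hinv, hinv, h, inv_one]
  have hthree (i j : Fin n) (h : f i * f j * f i = f j * f i * f j) : (f i * f j) ^ 3 = 1 := by
    calc (f i * f j) ^ 3 = (f i * f j * f i) * (f j * f i * f j) := by
          simp only [pow_succ, pow_zero, one_mul, mul_assoc]
      _ = (f j * f i * f j)⁻¹ * (f j * f i * f j) := by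
          rw [h]; simp only [mul_inv_rev, hinv, mul_assoc]
      _ = 1 := inv_mul_cancel _
  have htwo (i j : Fin n) (h : f i * f j = f j * f i) : (f i * f j) ^ 2 = 1 := by
    rw [pow_two]; nth_rw 2 [h]; rw [mul_assoc, ← mul_assoc (f j), hsq, one_mul, hsq]
  intro i j
  rw [typeB_apply]
  split_ifs with h1 h2 h3
  · rw [Fin.ext h1, hsq, one_pow]
  · rcases h2 with ⟨hi, hj⟩ | ⟨hi, hj⟩
    · exact hfour i j hi hj
    · exact hflip _ _ _ (hfour j i hj hi)
  · rcases h3 with h | h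
    · exact hthree _ _ (hbraid i j (by omega) h)
    · exact hflip _ _ _ (hthree _ _ (hbraid j i (by omega) h))
  · rcases lt_or_gt_of_ne h1 with h | h
    · exact htwo _ _ (hcomm i j (by omega))
    · exact hflip _ _ _ (htwo _ _ (hcomm j i (by omega)))

/-- The action of `B_n` on `ℤ` by signed permutations. -/
def signedRep (n : ℕ) : BGroup n →* Equiv.Perm ℤ :=
  (typeB n).toCoxeterSystem.lift ⟨fun i => signedSwap i, typeB_isLiftable
    (fun i => signedSwap_mul_self i) (fun _ _ h => signedSwap_comm h)
    (fun _ _ hi h => by rw [← h]; exact signedSwap_braid hi)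
    (fun _ _ hi hj => by rw [hi, hj]; exact signedSwap_zero_one)⟩

@[simp]
theorem signedRep_sB (n : ℕ) (i : Fin n) : signedRep n (sB n i) = signedSwap i := by
  rw [sB, ← CoxeterMatrix.toCoxeterSystem_simple]
  exact CoxeterSystem.lift_apply_simple _ _ i

theorem signedRep_one_sub {n : ℕ} (g : BGroup n) (x : ℤ) :
    signedRep n g (1 - x) = 1 - signedRep n g x := by
  induction g using (typeB n).toCoxeterSystem.simple_induction_left generalizing x with
  | one => simp
  | mul_simple_left g i ih =>
    rw [CoxeterMatrix.toCoxeterSystem_simple, ← sB, map_mul, signedRep_sB]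
    simp only [Equiv.Perm.mul_apply, ih, signedSwap_one_sub]

/-! ### Relations in `B_n`, and the retraction that kills `s_0` -/

theorem sB_mul_self {n : ℕ} (i : Fin n) : sB n i * sB n i = 1 := by
  rw [sB, ← CoxeterMatrix.toCoxeterSystem_simple]
  exact CoxeterSystem.simple_mul_simple_self _ i

theorem sB_inv {n : ℕ} (i : Fin n) : (sB n i)⁻¹ = sB n i :=
  inv_eq_of_mul_eq_one_left (sB_mul_self i)

theorem sB_mul_sB_pow {n : ℕ} (i j : Fin n) : (sB n i * sB n j) ^ typeB n i j = 1 := by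
  simp only [sB, ← CoxeterMatrix.toCoxeterSystem_simple]
  exact CoxeterSystem.simple_mul_simple_pow _ i j

theorem sB_comm {n : ℕ} {i j : Fin n} (h : (i : ℕ) + 2 ≤ j) :
    sB n i * sB n j = sB n j * sB n i := by
  have := sB_mul_sB_pow i j
  rw [typeB_apply, if_neg (by omega), if_neg (by omega), if_neg (by omega), pow_two] at this
  rw [← inv_eq_of_mul_eq_one_left this, mul_inv_rev, sB_inv, sB_inv]

theorem sB_braid {n : ℕ} {i j : Fin n} (hi : 1 ≤ (i : ℕ)) (h : (i : ℕ) + 1 = j) :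
    sB n i * sB n j * sB n i = sB n j * sB n i * sB n j := by
  have := sB_mul_sB_pow i j
  rw [typeB_apply, if_neg (by omega), if_neg (by omega), if_pos (by omega)] at this
  have h' : (sB n i * sB n j * sB n i) * (sB n j * sB n i * sB n j) = 1 := by
    rw [← this]; simp only [pow_succ, pow_zero, one_mul, mul_assoc]
  rw [← inv_eq_of_mul_eq_one_left h']
  simp only [mul_inv_rev, sB_inv, mul_assoc]

/-- The retraction of `B_n` onto its parabolic subgroup generated by `s_1, …, s_{n-1}` that sends
`s_0` to `1`. -/
def killZero (n : ℕ) : BGroup n →* BGroup n :=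
  (typeB n).toCoxeterSystem.lift ⟨fun i => if (i : ℕ) = 0 then 1 else sB n i, typeB_isLiftable
    (fun i => by split_ifs <;> simp [sB_mul_self])
    (fun i j h => by
      split_ifs <;> first | exact sB_comm h | simp)
    (fun i j hi h => by
      rw [if_neg (by omega), if_neg (by omega)]; exact sB_braid hi h)
    (fun i j hi hj => by
      rw [if_pos hi, if_neg (by omega), one_mul, show 4 = 2 * 2 from rfl, pow_mul,
        pow_two (sB n j), sB_mul_self, one_pow])⟩

theorem killZero_sB (n : ℕ) (i : Fin n) :
    killZero n (sB n i) = if (i : ℕ) = 0 then 1 else sB n i := by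
  rw [sB, ← CoxeterMatrix.toCoxeterSystem_simple]
  exact CoxeterSystem.lift_apply_simple _ _ i

theorem killZero_of_mem_dotS {n : ℕ} {w : BGroup n} (hw : w ∈ dotS n) : killZero n w = w := by
  have : dotS n ≤ (killZero n).eqLocus (MonoidHom.id _) := by
    rw [dotS, Subgroup.closure_le]
    rintro _ ⟨i, hi, rfl⟩
    change killZero n (sB n i) = sB n i
    rw [killZero_sB, if_neg (by omega)]
  exact this hw

theorem killZero_wordProd {n : ℕ} (L : List (Fin n)) :
    killZero n ((typeB n).toCoxeterSystem.wordProd L) =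
      (typeB n).toCoxeterSystem.wordProd (L.filter fun i => (i : ℕ) ≠ 0) := by
  induction L with
  | nil => simp
  | cons i L ih =>
    rw [CoxeterSystem.wordProd_cons, map_mul, ih, CoxeterMatrix.toCoxeterSystem_simple, ← sB,
      killZero_sB, List.filter_cons]
    split_ifs <;> simp_all [CoxeterSystem.wordProd_cons, sB]

/-- Deleting every `s_0` from a reduced word of `w` spells the image of `w`. -/
theorem length_killZero_le {n : ℕ} (w : BGroup n) :
    (typeB n).toCoxeterSystem.length (killZero n w) ≤ (typeB n).toCoxeterSystem.length w := by
  obtain ⟨L, hL, rfl⟩ := (typeB n).toCoxeterSystem.exists_isReduced w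
  rw [killZero_wordProd, hL.eq]
  exact (CoxeterSystem.length_wordProd_le _ _).trans (List.length_filter_le _ _)

/-! ### Faithfulness of the representation on `dotS` -/

/-- The subgroup of `B_n` generated by `s_1, …, s_k`. -/
def lowerSubgroup (n k : ℕ) : Subgroup (BGroup n) :=
  Subgroup.closure {g | ∃ i : Fin n, 1 ≤ (i : ℕ) ∧ (i : ℕ) ≤ k ∧ g = sB n i}

theorem sB_mem_lowerSubgroup {n k : ℕ} {i : Fin n} (h1 : 1 ≤ (i : ℕ)) (hk : (i : ℕ) ≤ k) :
    sB n i ∈ lowerSubgroup n k :=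
  Subgroup.subset_closure ⟨i, h1, hk, rfl⟩

theorem dotS_eq_lowerSubgroup (n : ℕ) : dotS n = lowerSubgroup n (n - 1) := by
  unfold dotS lowerSubgroup
  congr 1; ext g
  constructor
  · rintro ⟨i, hi, rfl⟩; exact ⟨i, hi, by omega, rfl⟩
  · rintro ⟨i, hi, _, rfl⟩; exact ⟨i, hi, rfl⟩

theorem lowerSubgroup_mono {n k l : ℕ} (h : k ≤ l) : lowerSubgroup n k ≤ lowerSubgroup n l := by
  refine Subgroup.closure_mono ?_
  rintro _ ⟨i, hi, hk, rfl⟩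
  exact ⟨i, hi, hk.trans h, rfl⟩

theorem lowerSubgroup_zero (n : ℕ) : lowerSubgroup n 0 = ⊥ := by
  rw [lowerSubgroup, Subgroup.closure_eq_bot_iff]
  rintro _ ⟨i, hi, hk, rfl⟩
  omega

theorem sB_commute_of_mem_lowerSubgroup {n k : ℕ} {i : Fin n} (hi : k + 2 ≤ (i : ℕ))
    {g : BGroup n} (hg : g ∈ lowerSubgroup n k) : g * sB n i = sB n i * g := by
  have : lowerSubgroup n k ≤ Subgroup.centralizer {sB n i} := by
    rw [lowerSubgroup, Subgroup.closure_le]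
    rintro _ ⟨j, _, hk, rfl⟩
    rw [SetLike.mem_coe, Subgroup.mem_centralizer_singleton_iff]
    exact (sB_comm (by omega))
  exact (Subgroup.mem_centralizer_singleton_iff.1 (this hg))

/-- The product `s_k s_{k-1} ⋯ s_j`, the representatives of minimal length of the cosets of
`⟨s_1, …, s_{k-1}⟩` in `⟨s_1, …, s_k⟩`. -/
def cosetRep (n : ℕ) : ℕ → ℕ → BGroup n
  | 0, _ => 1
  | k + 1, j => if h : k + 1 < n ∧ j ≤ k + 1 then sB n ⟨k + 1, h.1⟩ * cosetRep n k j else 1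

theorem cosetRep_self (n k : ℕ) : cosetRep n k (k + 1) = 1 := by
  cases k <;> simp [cosetRep]

theorem cosetRep_succ {n k j : ℕ} (hk : k + 1 < n) (hj : j ≤ k + 1) :
    cosetRep n (k + 1) j = sB n ⟨k + 1, hk⟩ * cosetRep n k j := by
  rw [cosetRep, dif_pos ⟨hk, hj⟩]

theorem cosetRep_mem {n k j : ℕ} : cosetRep n k j ∈ lowerSubgroup n k := by
  induction k with
  | zero => exact one_mem _
  | succ k ih =>
    rw [cosetRep]
    split_ifs with h
    · exact mul_mem (sB_mem_lowerSubgroup (by simp) (by simp)) (lowerSubgroup_mono (by omega) ih)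
    · exact one_mem _

/-- Right multiplication by `s_i` permutes the cosets of ⟨s_1, …, s_{k-1}⟩ in ⟨s_1, …, s_k⟩ just as
`signedSwap i` permutes the labels 1, …, k+1. Only commutation and braid relations are needed. -/
theorem exists_cosetRep_mul_sB {n k : ℕ} (hk : k < n) {i : Fin n} (hi : 1 ≤ (i : ℕ))
    (hik : (i : ℕ) ≤ k) {j : ℕ} (hj : 1 ≤ j) (hjk : j ≤ k + 1) :
    ∃ y ∈ lowerSubgroup n (k - 1), ∃ j' : ℕ, 1 ≤ j' ∧ j' ≤ k + 1 ∧ signedSwap i j' = j ∧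
      cosetRep n k j * sB n i = y * cosetRep n k j' := by
  induction k generalizing i j with
  | zero => omega
  | succ k ih =>
    rcases Nat.lt_or_ge (k + 1) j with hjk' | hjk'
    · obtain rfl : j = k + 1 + 1 := by omega
      rcases Nat.lt_or_ge k i with hik' | hik'
      · have hik'' : (i : ℕ) = k + 1 := by omega
        refine ⟨1, one_mem _, k + 1, by omega, by omega, ?_, ?_⟩
        · rw [signedSwap_apply_up (by omega)]; push_cast; ring
        · rw [cosetRep_self, cosetRep_succ hk le_rfl, cosetRep_self, one_mul, one_mul, mul_one]
          congr 1; exact Fin.ext hik''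
      · refine ⟨sB n i, sB_mem_lowerSubgroup hi (by omega), k + 1 + 1, by omega, by omega, ?_, ?_⟩
        · rw [signedSwap_apply_of_ne (by omega)]
        · rw [cosetRep_self, mul_one, one_mul]
    · rw [cosetRep_succ hk hjk']
      rcases Nat.lt_or_ge k i with hik' | hik'
      · have hik'' : i = ⟨k + 1, hk⟩ := Fin.ext (by simp; omega)
        rcases Nat.lt_or_ge k j with hjk'' | hjk''
        · obtain rfl : j = k + 1 := by omega
          refine ⟨1, one_mem _, k + 1 + 1, by omega, by omega, ?_, ?_⟩
          · rw [signedSwap_apply_down (by rw [hik'']; push_cast; omega)]; push_cast; ring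
          · rw [cosetRep_self, cosetRep_self, mul_one, mul_one, hik'', sB_mul_self]
        · obtain ⟨l, rfl⟩ : ∃ l, k = l + 1 := ⟨k - 1, by omega⟩
          refine ⟨sB n ⟨l + 1, by omega⟩, sB_mem_lowerSubgroup (by simp) (by simp), j, by omega,
            by omega, ?_, ?_⟩
          · rw [signedSwap_apply_of_ne (by rw [hik'']; push_cast; omega)]
          · rw [cosetRep_succ hk hjk', cosetRep_succ (by omega) hjk'']
            have hc := sB_commute_of_mem_lowerSubgroup (i := i) (by omega)
              (cosetRep_mem (n := n) (k := l) (j := j))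
            have hb := sB_braid (i := ⟨l + 1, by omega⟩) (j := i) (by simp) (by simp; omega)
            rw [← hik'', mul_assoc, mul_assoc, hc]
            simp only [← mul_assoc]
            rw [hb]
      · obtain ⟨y, hy, j', hj1, hj2, hs, he⟩ := ih (by omega) hi hik' hj hjk'
        refine ⟨y, lowerSubgroup_mono (by omega) hy, j', hj1, by omega, hs, ?_⟩
        rw [cosetRep_succ hk hj2, mul_assoc, he, ← mul_assoc, ← mul_assoc,
          sB_commute_of_mem_lowerSubgroup (by simp; omega) hy]

theorem exists_cosetRep_mul {n k : ℕ} (hk : k < n) {w : BGroup n} (hw : w ∈ lowerSubgroup n k)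
    {j : ℕ} (hj : 1 ≤ j) (hjk : j ≤ k + 1) :
    ∃ y ∈ lowerSubgroup n (k - 1), ∃ j' : ℕ, 1 ≤ j' ∧ j' ≤ k + 1 ∧ signedRep n w j' = j ∧
      cosetRep n k j * w = y * cosetRep n k j' := by
  have step {x : BGroup n} {i : Fin n} (h1 : 1 ≤ (i : ℕ)) (hik : (i : ℕ) ≤ k)
      (ih : ∃ y ∈ lowerSubgroup n (k - 1), ∃ j' : ℕ, 1 ≤ j' ∧ j' ≤ k + 1 ∧ signedRep n x j' = j ∧
        cosetRep n k j * x = y * cosetRep n k j') :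
      ∃ y ∈ lowerSubgroup n (k - 1), ∃ j' : ℕ, 1 ≤ j' ∧ j' ≤ k + 1 ∧
        signedRep n (x * sB n i) j' = j ∧
        cosetRep n k j * (x * sB n i) = y * cosetRep n k j' := by
    obtain ⟨y, hy, j', hj1, hj2, hs, he⟩ := ih
    obtain ⟨y', hy', j'', hj1', hj2', hs', he'⟩ := exists_cosetRep_mul_sB hk h1 hik hj1 hj2
    refine ⟨y * y', mul_mem hy hy', j'', hj1', hj2', ?_, ?_⟩
    · rw [map_mul, signedRep_sB, Equiv.Perm.mul_apply, hs', hs]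
    · rw [← mul_assoc, he, mul_assoc, he', mul_assoc]
  induction hw using Subgroup.closure_induction_right with
  | one => exact ⟨1, one_mem _, j, hj, hjk, by simp, by simp⟩
  | mul_right x _ y hy ih =>
    obtain ⟨i, h1, hik, rfl⟩ := hy
    exact step h1 hik ih
  | mul_inv_cancel x _ y hy ih =>
    obtain ⟨i, h1, hik, rfl⟩ := hy
    rw [sB_inv]
    exact step h1 hik ih

/-- An element acting trivially fixes the label of the trivial coset, hence lies in the next smaller
subgroup; descend to the trivial one. -/
theorem eq_one_of_signedRep_eq_one {n k : ℕ} (hk : k < n) {w : BGroup n}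
    (hw : w ∈ lowerSubgroup n k) (h : signedRep n w = 1) : w = 1 := by
  induction k with
  | zero => rwa [lowerSubgroup_zero, Subgroup.mem_bot] at hw
  | succ k ih =>
    obtain ⟨y, hy, j', hj1, hj2, hs, he⟩ := exists_cosetRep_mul hk hw (j := k + 1 + 1) (by omega)
      le_rfl
    rw [h, Equiv.Perm.one_apply, Nat.cast_inj] at hs
    rw [hs, cosetRep_self, one_mul, mul_one] at he
    exact ih (by omega) (he ▸ hy)

theorem signedRep_injOn_dotS (n : ℕ) : Set.InjOn (signedRep n) (dotS n) := by
  rcases Nat.eq_zero_or_pos n with rfl | hn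
  · intro v hv w hw _
    rw [dotS_eq_lowerSubgroup, lowerSubgroup_zero, SetLike.mem_coe, Subgroup.mem_bot] at hv hw
    rw [hv, hw]
  intro v hv w hw h
  rw [← mul_inv_eq_one]
  refine eq_one_of_signedRep_eq_one (k := n - 1) (by omega) ?_ ?_
  · rw [← dotS_eq_lowerSubgroup]
    exact mul_mem hv (inv_mem hw)
  · rw [map_mul, map_inv, h, mul_inv_cancel]

/-! ### Descents as inversions of the inverse -/

theorem sB_mem_dotS {n : ℕ} {i : Fin n} (h : 1 ≤ (i : ℕ)) : sB n i ∈ dotS n :=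
  Subgroup.subset_closure ⟨i, h, rfl⟩

theorem signedRep_pos_iff {n : ℕ} {w : BGroup n} (hw : w ∈ dotS n) (x : ℤ) :
    1 ≤ signedRep n w x ↔ 1 ≤ x := by
  induction hw using Subgroup.closure_induction generalizing x with
  | mem g hg =>
    obtain ⟨i, hi, rfl⟩ := hg
    rw [signedRep_sB, signedSwap_apply]
    split_ifs <;> omega
  | one => simp
  | mul g h _ _ hg hh => rw [map_mul, Equiv.Perm.mul_apply, hg, hh]
  | inv g _ hg => rw [← hg, map_inv, ← Equiv.Perm.mul_apply, mul_inv_cancel, Equiv.Perm.one_apply]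

theorem signedRep_inv_eq_iff {n : ℕ} {g : BGroup n} {x y : ℤ} :
    signedRep n g⁻¹ x = y ↔ signedRep n g y = x := by
  rw [map_inv, Equiv.Perm.inv_eq_iff_eq, eq_comm]

/-- Conjugation carries the swap of a, a+1 to the swap of their images; the symmetry `x ↦ 1 - x`
takes care of the mirrored pair. -/
theorem signedSwap_comp_eq {n : ℕ} {g : BGroup n} {r a : ℕ} (hr : signedRep n g a = r)
    (hr' : signedRep n g (a + 1) = r + 1) (x : ℤ) :
    signedSwap r (signedRep n g (signedSwap a x)) = signedRep n g x := by
  have h1 : signedRep n g (-a) = -r := by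
    rw [show (-a : ℤ) = 1 - (a + 1) by ring, signedRep_one_sub, hr']; ring
  have h2 : signedRep n g (1 - a) = 1 - r := by rw [signedRep_one_sub, hr]
  have s1 (i : ℕ) : signedSwap i i = i + 1 := signedSwap_apply_up (by omega)
  have s2 (i : ℕ) : signedSwap i (i + 1) = i := by
    rw [signedSwap_apply_down (by omega), add_sub_cancel_right]
  have s3 (i : ℕ) : signedSwap i (-i) = 1 - i := by
    rw [signedSwap_apply_up (by omega)]; ring
  have s4 (i : ℕ) : signedSwap i (1 - i) = -i := by
    rw [signedSwap_apply_down (by omega)]; ring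
  have hx : x = a ∨ x = a + 1 ∨ x = -a ∨ x = 1 - a ∨
    (x ≠ a ∧ x ≠ a + 1 ∧ x ≠ -a ∧ x ≠ 1 - a) := by omega
  rcases hx with rfl | rfl | rfl | rfl | hx
  · rw [s1, hr', s2, hr]
  · rw [s2, hr, hr', s1]
  · rw [s3, h1, h2, s4]
  · rw [s4, h1, h2, s3]
  · rw [signedSwap_apply_of_ne hx, signedSwap_apply_of_ne]
    rw [← hr', ← hr, ← h1, ← h2] at *
    simpa only [ne_eq, EmbeddingLike.apply_eq_iff_eq] using hx

/-- The exchange condition. Either the word without its last letter `s_a` already has the inversion,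
or `s_a` creates it; then the prefix `g` takes a, a+1 to r, r+1, so `s_r g s_a = g` and the last
letter can be dropped. -/
theorem exists_shorter_word {n : ℕ} {r : Fin n} (hr : 1 ≤ (r : ℕ)) (L : List (Fin n))
    (hL : ∀ i ∈ L, 1 ≤ (i : ℕ))
    (hlt : signedRep n ((typeB n).toCoxeterSystem.wordProd L)⁻¹ (r + 1) <
      signedRep n ((typeB n).toCoxeterSystem.wordProd L)⁻¹ r) :
    ∃ L' : List (Fin n), L'.length < L.length ∧
      (typeB n).toCoxeterSystem.wordProd L' = sB n r * (typeB n).toCoxeterSystem.wordProd L := by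
  induction L using List.reverseRecOn with
  | nil => simp at hlt
  | append_singleton L a ih =>
    have hmem (M : List (Fin n)) (hM : ∀ i ∈ M, 1 ≤ (i : ℕ)) :
        (typeB n).toCoxeterSystem.wordProd M ∈ dotS n := by
      rw [CoxeterSystem.wordProd]
      refine list_prod_mem fun x hx => ?_
      obtain ⟨i, hi, rfl⟩ := List.mem_map.1 hx
      exact sB_mem_dotS (hM i hi)
    have hL1 : ∀ i ∈ L, 1 ≤ (i : ℕ) := fun i hi => hL i (by simp [hi])
    have ha : 1 ≤ (a : ℕ) := hL a (by simp)
    have hP : (typeB n).toCoxeterSystem.wordProd (L ++ [a]) =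
        (typeB n).toCoxeterSystem.wordProd L * sB n a := by
      rw [CoxeterSystem.wordProd_append, CoxeterSystem.wordProd_singleton,
        CoxeterMatrix.toCoxeterSystem_simple, sB]
    have hg := hmem L hL1
    rw [hP] at hlt ⊢
    set g := (typeB n).toCoxeterSystem.wordProd L
    rcases lt_or_ge (signedRep n g⁻¹ (r + 1)) (signedRep n g⁻¹ r) with h | h
    · obtain ⟨L', hlen, hL'⟩ := ih hL1 h
      refine ⟨L' ++ [a], by simpa using hlen, ?_⟩
      rw [CoxeterSystem.wordProd_append, CoxeterSystem.wordProd_singleton, hL',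
        CoxeterMatrix.toCoxeterSystem_simple, ← sB, mul_assoc]
    · refine ⟨L, by simp, ?_⟩
      have hp := (signedRep_pos_iff (inv_mem hg) r).2 (by omega)
      have hne : signedRep n g⁻¹ r ≠ signedRep n g⁻¹ (r + 1) := by
        rw [ne_eq, EmbeddingLike.apply_eq_iff_eq]; omega
      rw [mul_inv_rev, sB_inv, map_mul, Equiv.Perm.mul_apply, Equiv.Perm.mul_apply,
        signedRep_sB, signedSwap_apply, signedSwap_apply] at hlt
      have h1 : signedRep n g⁻¹ r = (a : ℕ) ∧ signedRep n g⁻¹ (r + 1) = (a : ℕ) + 1 := by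
        generalize signedRep n g⁻¹ r = p at *
        generalize signedRep n g⁻¹ (r + 1) = q at *
        split_ifs at hlt <;> omega
      refine signedRep_injOn_dotS n hg (mul_mem (sB_mem_dotS hr)
        (mul_mem hg (sB_mem_dotS ha))) ?_
      ext x
      simp only [map_mul, Equiv.Perm.mul_apply, signedRep_sB]
      exact (signedSwap_comp_eq (signedRep_inv_eq_iff.1 h1.1) (signedRep_inv_eq_iff.1 h1.2) x).symm

theorem length_sB_mul_lt {n : ℕ} {w : BGroup n} (hw : w ∈ dotS n) {r : Fin n} (hr : 1 ≤ (r : ℕ))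
    (hlt : signedRep n w⁻¹ (r + 1) < signedRep n w⁻¹ r) :
    (typeB n).toCoxeterSystem.length (sB n r * w) < (typeB n).toCoxeterSystem.length w := by
  obtain ⟨L, hL, hLw⟩ := (typeB n).toCoxeterSystem.exists_isReduced w
  -- A reduced word in `B_n` might a priori contain `s_0`; the retraction fixes `w`, so these
  -- letters may be dropped.
  have hw' : w = (typeB n).toCoxeterSystem.wordProd (L.filter fun i => (i : ℕ) ≠ 0) := by
    rw [← killZero_wordProd, ← hLw, killZero_of_mem_dotS hw]
  obtain ⟨L', hlen, hL'⟩ := exists_shorter_word hr (L.filter fun i => (i : ℕ) ≠ 0)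
    (fun i hi => by have := List.of_mem_filter hi; simp at this; omega) (by rwa [← hw'])
  rw [hw', ← hL', ← hw', hLw, hL.eq]
  exact (CoxeterSystem.length_wordProd_le _ _).trans_lt
    (hlen.trans_le (List.length_filter_le _ _))

theorem length_sB_mul_lt_iff {n : ℕ} {w : BGroup n} (hw : w ∈ dotS n) {r : Fin n}
    (hr : 1 ≤ (r : ℕ)) :
    (typeB n).toCoxeterSystem.length (sB n r * w) < (typeB n).toCoxeterSystem.length w ↔
      signedRep n w⁻¹ (r + 1) < signedRep n w⁻¹ r := by
  refine ⟨fun h => ?_, length_sB_mul_lt hw hr⟩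
  by_contra hle
  have hne : signedRep n w⁻¹ r ≠ signedRep n w⁻¹ (r + 1) := by
    rw [ne_eq, EmbeddingLike.apply_eq_iff_eq]; omega
  -- Without an inversion at `r` in `w⁻¹`, there is one for `s_r w`, which `s_r` then shortens back
  -- to `w`.
  have := length_sB_mul_lt (mul_mem (sB_mem_dotS hr) hw) hr
    (by
      rw [mul_inv_rev, sB_inv, map_mul, signedRep_sB, Equiv.Perm.mul_apply, Equiv.Perm.mul_apply,
        signedSwap_apply_up (x := (r : ℕ)) (by omega),
        signedSwap_apply_down (x := (r : ℕ) + 1) (by omega), add_sub_cancel_right]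
      omega)
  rw [← mul_assoc, sB_mul_self, one_mul] at this
  omega

theorem le_length_sB_zero_mul {n : ℕ} {w : BGroup n} (hw : w ∈ dotS n) {r : Fin n}
    (hr : (r : ℕ) = 0) :
    (typeB n).toCoxeterSystem.length w ≤ (typeB n).toCoxeterSystem.length (sB n r * w) := by
  have := length_killZero_le (sB n r * w)
  rwa [map_mul, killZero_sB, if_pos hr, one_mul, killZero_of_mem_dotS hw] at this

theorem mem_desB_iff {n : ℕ} {w : BGroup n} (hw : w ∈ dotS n) (r : ℕ) :
    r ∈ desB n w ↔ 1 ≤ r ∧ r < n ∧ signedRep n w⁻¹ (r + 1) < signedRep n w⁻¹ r := by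
  constructor
  · rintro ⟨h, hlt⟩
    have hr : 1 ≤ r := by
      by_contra h0
      have := le_length_sB_zero_mul hw (r := ⟨r, h⟩) (by simp; omega)
      omega
    exact ⟨hr, h, (length_sB_mul_lt_iff hw (r := ⟨r, h⟩) hr).1 hlt⟩
  · rintro ⟨hr, h, hlt⟩
    exact ⟨h, (length_sB_mul_lt_iff hw (r := ⟨r, h⟩) hr).2 hlt⟩

/-! ### The action of the powers of `τ_k` -/

theorem tauB_succ {n k : ℕ} (hk : k + 1 ≤ n) :
    tauB n (k + 1) hk = tauB n k (by omega) * sB n ⟨k, hk⟩ := by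
  rw [tauB, List.ofFn_succ', List.prod_concat]
  rfl

theorem signedRep_tauB {n k : ℕ} (hk : k ≤ n) {x : ℤ} (hx : 1 ≤ x) :
    signedRep n (tauB n k hk) x = if x < k then x + 1 else if x = k then 0 else x := by
  induction k generalizing x with
  | zero =>
    rw [if_neg (by omega), if_neg (by omega)]
    simp [tauB]
  | succ k ih =>
    rw [tauB_succ, map_mul, Equiv.Perm.mul_apply, signedRep_sB]
    have hx' : x < k ∨ x = k ∨ x = k + 1 ∨ (k : ℤ) + 1 < x := by omega
    rcases hx' with h | h | h | h
    · rw [signedSwap_apply_of_ne (by simp only; omega), ih _ hx, if_pos h,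
        if_pos (by push_cast; omega)]
    · rw [signedSwap_apply_up (by simp only; omega), ih _ (by omega), if_neg (by omega),
        if_neg (by omega), if_pos (by push_cast; omega)]
    · rw [signedSwap_apply_down (by simp only; omega), if_neg (by push_cast; omega),
        if_pos (by push_cast; omega), h, add_sub_cancel_right]
      rcases Nat.eq_zero_or_pos k with rfl | hk0
      · simp [tauB]
      · rw [ih _ (by omega), if_neg (by omega), if_pos rfl]
    · rw [signedSwap_apply_of_ne (by simp only; omega), ih _ hx, if_neg (by omega),
        if_neg (by omega), if_neg (by push_cast; omega), if_neg (by push_cast; omega)]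

theorem signedRep_tauB_pow {n k : ℕ} (hk : k ≤ n) {a : ℕ} (ha : a ≤ k) {x : ℤ} (hx : 1 ≤ x)
    (hxk : x ≤ k) :
    signedRep n (tauB n k hk ^ a) x = if x + a ≤ k then x + a else 1 + k - (x + a) := by
  induction a with
  | zero => simp [hxk]
  | succ a ih =>
    rw [pow_succ', map_mul, Equiv.Perm.mul_apply, ih (by omega)]
    push_cast
    split_ifs with h1 h2 h2
    · rw [signedRep_tauB hk (by omega), if_pos (by omega)]; ring
    · rw [signedRep_tauB hk (by omega), if_neg (by omega), if_pos (by omega)]; omega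
    · omega
    · rw [show (1 : ℤ) + k - (x + a) = 1 - (x + a - k) by ring, signedRep_one_sub,
        signedRep_tauB hk (by omega), if_pos (by omega)]
      ring

theorem signedRep_tauB_zpow {n k : ℕ} (hk : k ≤ n) {j : ℤ} (hj : -(k : ℤ) ≤ j) (hj' : j ≤ k)
    {x : ℤ} (hx : 1 ≤ x) (hxk : x ≤ k) :
    signedRep n (tauB n k hk ^ j) x =
      if x + j ≤ 0 then 1 - (x + j + k) else if x + j ≤ k then x + j else 1 - (x + j - k) := by
  obtain ⟨a, rfl | rfl⟩ := j.eq_nat_or_neg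
  · rw [zpow_natCast, signedRep_tauB_pow hk (by omega) hx hxk]
    split_ifs <;> omega
  · rw [zpow_neg, zpow_natCast, signedRep_inv_eq_iff]
    split_ifs with h1 h2
    · rw [signedRep_one_sub, signedRep_tauB_pow hk (by omega) (by omega) (by omega),
        if_neg (by omega)]
      ring
    · rw [signedRep_tauB_pow hk (by omega) (by omega) (by omega), if_pos (by omega)]
      ring
    · omega

theorem signedRep_tauB_zpow_of_lt {n k : ℕ} (hk : k ≤ n) (j : ℤ) {x : ℤ} (hx : (k : ℤ) < x) :
    signedRep n (tauB n k hk ^ j) x = x := by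
  rw [map_zpow]
  refine Equiv.Perm.zpow_apply_eq_self_of_apply_eq_self ?_ j
  rw [signedRep_tauB hk (by omega), if_neg (by omega), if_neg (by omega)]

theorem signedRep_prod_tauB_zpow_of_lt {n m : ℕ} {k : Fin m → ℕ} (i : Fin m → ℤ)
    (hk : ∀ j, k j ≤ n) {x : ℤ} (hx : ∀ j, (k j : ℤ) < x) :
    signedRep n (List.ofFn fun j => tauB n (k j) (hk j) ^ i j).prod x = x := by
  have : (List.ofFn fun j => tauB n (k j) (hk j) ^ i j).prod ∈
      (MulAction.stabilizer (Equiv.Perm ℤ) x).comap (signedRep n) := by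
    refine list_prod_mem fun g hg => ?_
    obtain ⟨j, rfl⟩ := List.mem_ofFn.1 hg
    exact signedRep_tauB_zpow_of_lt (hk j) (i j) (hx j)
  exact this

/-! ### The folded order and the induction on the factors -/

/-- The position of `x` in the order `1 < 2 < ⋯ < K < 0 < -1 < -2 < ⋯` on the integers `x ≤ K`. -/
def foldRank (K : ℕ) (x : ℤ) : ℤ := if 1 ≤ x then x else K + (1 - x)

/-- If `u x` is negative exactly for `x ≤ S`, then `u⁻¹ r` is either a positive integer
beyond `S` or the negative of one up to `S`. -/
theorem signedRep_inv_range {n k : ℕ} {S : ℤ} {u : BGroup n}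
    (hfix : ∀ x : ℤ, (k : ℤ) < x → signedRep n u x = x)
    (hS : ∀ x : ℤ, 1 ≤ x → (signedRep n u x ≤ 0 ↔ x ≤ S)) {r : ℤ} (hr : 1 ≤ r) (hrk : r ≤ k) :
    (1 ≤ signedRep n u⁻¹ r ∧ S < signedRep n u⁻¹ r ∧ signedRep n u⁻¹ r ≤ k) ∨
      (signedRep n u⁻¹ r ≤ 0 ∧ 1 - signedRep n u⁻¹ r ≤ S) := by
  have hv : signedRep n u (signedRep n u⁻¹ r) = r := signedRep_inv_eq_iff.1 rfl
  generalize signedRep n u⁻¹ r = v at *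
  rcases lt_or_ge 0 v with h | h
  · refine Or.inl ⟨h, ?_, ?_⟩
    · have := hS v h; omega
    · by_contra hlt
      have := hfix v (by omega)
      omega
  · refine Or.inr ⟨h, (hS _ (by omega)).1 ?_⟩
    rw [signedRep_one_sub, hv]; omega

/-- `τ_k^(-i)` subtracts i from the rank along the cycle, and `hv` excludes wrapping around.
Replacing k by K then raises only the nonpositive values, so the resulting map of ranks is strictly
increasing. -/
theorem foldRank_tauB_zpow {n k K : ℕ} (hk : k ≤ n) {i S : ℤ} (hi : -(k : ℤ) ≤ i)
    (hi' : i < k) (hS : 0 ≤ S) (hSk : S ≤ k) {v : ℤ}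
    (hv : (1 ≤ v ∧ S + i < v ∧ v ≤ k) ∨ (v ≤ 0 ∧ 1 - v ≤ S + i ∧ 1 - v ≤ k)) :
    foldRank K (signedRep n (tauB n k hk ^ (-i)) v) =
      if foldRank k v - i ≤ k then foldRank k v - i else foldRank k v - i + (K - k) := by
  rcases hv with ⟨h1, h2, h3⟩ | ⟨h1, h2, h3⟩
  · rw [signedRep_tauB_zpow hk (by omega) (by omega) h1 h3]
    simp only [foldRank]
    split_ifs <;> omega
  · have : signedRep n (tauB n k hk ^ (-i)) v =
        1 - signedRep n (tauB n k hk ^ (-i)) (1 - v) := by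
      rw [signedRep_one_sub]; ring
    rw [this, signedRep_tauB_zpow hk (by omega) (by omega) (by omega) h3]
    simp only [foldRank]
    split_ifs <;> omega

/-- Removing the last factor of a product of powers of the `τ_k` shifts the set
`{x | 1 ≤ x, u x < 0}`, if it is an initial segment. -/
theorem signedRep_nonpos_iff_of_mul_tauB_zpow {n k : ℕ} (hk : k ≤ n) (hk1 : 1 ≤ k) {i S : ℤ}
    (hi : -(k : ℤ) ≤ i) (hi' : i < k) (hS : 0 ≤ S) {u : BGroup n}
    (hfix : ∀ x : ℤ, (k : ℤ) ≤ x → signedRep n u x = x)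
    (hneg : ∀ x : ℤ, 1 ≤ x → (signedRep n (u * tauB n k hk ^ i) x ≤ 0 ↔ x ≤ S)) :
    S ≤ k ∧ 0 ≤ S + i ∧ S + i < k ∧
      ∀ x : ℤ, 1 ≤ x → (signedRep n u x ≤ 0 ↔ x ≤ S + i) := by
  have hSk : S ≤ k := by
    by_contra hlt
    have h := (hneg S (by omega)).2 le_rfl
    rw [map_mul, Equiv.Perm.mul_apply, signedRep_tauB_zpow_of_lt hk i (by omega),
      hfix _ (by omega)] at h
    omega
  have hu {x : ℤ} (h1 : 1 ≤ x) (h2 : x ≤ k) : signedRep n u x =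
      signedRep n (u * tauB n k hk ^ i)
        (if x - i ≤ 0 then 1 - (x - i + k) else if x - i ≤ k then x - i else 1 - (x - i - k)) := by
    have := signedRep_tauB_zpow hk (j := -i) (by omega) (by omega) h1 h2
    rw [← sub_eq_add_neg] at this
    rw [← this, ← Equiv.Perm.mul_apply, ← map_mul, mul_assoc, ← zpow_add, add_neg_cancel, zpow_zero,
      mul_one]
  -- Since `u` fixes k, the sign of the full product at `τ_k^(-i)(k)` bounds S + i: from above if `i
  -- ≥ 0`, from below if `i < 0`.
  have hk' := hu (x := k) (by omega) le_rfl
  rw [hfix _ le_rfl] at hk'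
  have hbound : 0 ≤ S + i ∧ S + i < k := by
    split_ifs at hk' with h1 h2
    · omega
    · have := hneg (k - i) (by omega); omega
    · have := hneg (k - i - k) (by omega)
      rw [signedRep_one_sub] at hk'
      omega
  refine ⟨hSk, hbound.1, hbound.2, fun x hx => ?_⟩
  rcases lt_or_ge (k : ℤ) x with hxk | hxk
  · rw [hfix _ hxk.le]; omega
  · rw [hu hx hxk]
    split_ifs with h1 h2
    · have := hneg (x - i + k) (by omega)
      rw [signedRep_one_sub]; omega
    · rw [hneg _ (by omega)]; omega
    · have := hneg (x - i - k) (by omega)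
      rw [signedRep_one_sub]; omega

theorem foldRank_descent_iff {n m : ℕ} {k : Fin m → ℕ} {i : Fin m → ℤ}
    (hk_mono : StrictMono k) (hk_one : ∀ j, 1 ≤ k j) (hk_le : ∀ j, k j ≤ n)
    (hi_ge : ∀ j, -(k j : ℤ) ≤ i j) (hi_lt : ∀ j, i j < (k j : ℤ)) {K : ℕ} (hK : ∀ j, k j < K)
    {S : ℤ} (hS : 0 ≤ S) (hSK : S < K)
    (hneg : ∀ x : ℤ, 1 ≤ x →
      (signedRep n (List.ofFn fun j => tauB n (k j) (hk_le j) ^ i j).prod x ≤ 0 ↔ x ≤ S))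
    {r : ℕ} (hr : 1 ≤ r) (hrK : r < K) :
    foldRank K (signedRep n (List.ofFn fun j => tauB n (k j) (hk_le j) ^ i j).prod⁻¹ (r + 1)) <
      foldRank K (signedRep n (List.ofFn fun j => tauB n (k j) (hk_le j) ^ i j).prod⁻¹ r) ↔
      ∃ j, r = k j ∧ i j < 0 := by
  induction m generalizing K S r with
  | zero =>
    simp only [List.ofFn_zero, List.prod_nil, inv_one, map_one, Equiv.Perm.one_apply, foldRank,
      IsEmpty.exists_iff, iff_false]
    split_ifs <;> omega
  | succ m ih =>
    have hlast (j : Fin m) : k j.castSucc < k (Fin.last m) := hk_mono (Fin.castSucc_lt_last j)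
    have hfix {x : ℤ} (hx : (k (Fin.last m) : ℤ) ≤ x) := signedRep_prod_tauB_zpow_of_lt
      (fun j : Fin m => i j.castSucc) (fun j => hk_le j.castSucc) (x := x)
      (fun j => by have := hlast j; omega)
    have ih' {S : ℤ} := @ih (fun j => k j.castSucc) (fun j => i j.castSucc)
      (hk_mono.comp (Fin.strictMono_castSucc)) (fun j => hk_one _) (fun j => hk_le _)
      (fun j => hi_ge _) (fun j => hi_lt _) (k (Fin.last m)) hlast S
    simp only [List.ofFn_succ', List.prod_concat] at hneg ⊢
    generalize (List.ofFn fun j : Fin m =>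
      tauB n (k j.castSucc) (hk_le j.castSucc) ^ i j.castSucc).prod = u at *
    rw [Fin.exists_fin_succ']
    have hi := hi_ge (Fin.last m)
    have hi' := hi_lt (Fin.last m)
    have hk1 := hk_one (Fin.last m)
    have hkK := hK (Fin.last m)
    have hkn := hk_le (Fin.last m)
    obtain ⟨hSk, hS0, hSl, hneg'⟩ :=
      signedRep_nonpos_iff_of_mul_tauB_zpow hkn hk1 hi hi' hS (fun x hx => hfix hx) hneg
    have hinv {x : ℤ} (hx : (k (Fin.last m) : ℤ) ≤ x) : signedRep n u⁻¹ x = x :=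
      signedRep_inv_eq_iff.2 (hfix hx)
    simp only [mul_inv_rev, ← zpow_neg, map_mul, Equiv.Perm.mul_apply]
    rcases lt_trichotomy r (k (Fin.last m)) with h | h | h
    · have h1 := signedRep_inv_range (fun x hx => hfix hx.le) hneg' (r := r) (by omega) (by omega)
      have h2 := signedRep_inv_range (fun x hx => hfix hx.le) hneg' (r := r + 1) (by omega)
        (by omega)
      rw [foldRank_tauB_zpow hkn hi hi' hS hSk (by omega),
        foldRank_tauB_zpow hkn hi hi' hS hSk (by omega),
        ← ih' hS0 hSl hneg' hr h]
      split_ifs <;> omega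
    · have hne : ¬ ∃ j : Fin m, r = k j.castSucc ∧ i j.castSucc < 0 := by
        rintro ⟨j, hj, _⟩; have := hlast j; omega
      subst h
      -- The earlier `k_j` are smaller, so `u⁻¹` fixes both k and k+1, and the sign of the last
      -- exponent alone decides.
      rw [hinv (by omega), hinv le_rfl, signedRep_tauB_zpow_of_lt hkn _ (by omega),
        signedRep_tauB_zpow hkn (by omega) (by omega) (by omega) le_rfl]
      simp only [hne, false_or, true_and, foldRank]
      split_ifs <;> omega
    · have hne : ¬ ∃ j : Fin m, r = k j.castSucc ∧ i j.castSucc < 0 := by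
        rintro ⟨j, hj, _⟩; have := hlast j; omega
      rw [hinv (by omega), hinv (by omega), signedRep_tauB_zpow_of_lt hkn _ (by omega),
        signedRep_tauB_zpow_of_lt hkn _ (by omega)]
      simp only [hne, false_or, foldRank]
      split_ifs <;> omega

theorem mainTheorem9 (n : ℕ) (w : BGroup n) (hw : w ∈ dotS n)
    (m : ℕ) (k : Fin m → ℕ) (i : Fin m → ℤ)
    (hk_mono : StrictMono k) (hk_one : ∀ j, 1 ≤ k j) (hk_le : ∀ j, k j ≤ n)
    (hi_ge : ∀ j, -(k j : ℤ) ≤ i j) (hi_lt : ∀ j, i j < (k j : ℤ))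
    (hprod : w = (List.ofFn fun j : Fin m => tauB n (k j) (hk_le j) ^ i j).prod) :
    (∀ j : Fin m, k j ∈ desB n w ↔ i j < 0) ∧
      desB n w = {r : ℕ | ∃ j : Fin m, r = k j ∧ i j < 0} := by
  have key {r : ℕ} (hr : 1 ≤ r) (hrn : r ≤ n) :
      signedRep n w⁻¹ (r + 1) < signedRep n w⁻¹ r ↔ ∃ j, r = k j ∧ i j < 0 := by
    have h1 := (signedRep_pos_iff (inv_mem hw) r).2 (by omega)
    have h2 := (signedRep_pos_iff (inv_mem hw) (r + 1)).2 (by omega)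
    -- K = n + 1 lets `r = n` through, which is needed to exclude a negative exponent at `k_j = n`.
    have h := foldRank_descent_iff hk_mono hk_one hk_le hi_ge hi_lt (K := n + 1)
      (fun j => Nat.lt_succ_of_le (hk_le j)) (S := 0) le_rfl (by omega)
      (fun x hx => by have := (signedRep_pos_iff hw x).2 hx; rw [← hprod]; omega) hr
      (Nat.lt_succ_of_le hrn)
    rwa [← hprod, foldRank, foldRank, if_pos h1, if_pos h2] at h
  have hlt (j : Fin m) (hj : i j < 0) : k j < n := by
    refine lt_of_le_of_ne (hk_le j) fun hn => ?_
    have h := (key (hk_one j) (hk_le j)).2 ⟨j, rfl, hj⟩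
    have hfix : signedRep n w⁻¹ ((k j : ℤ) + 1) = k j + 1 := by
      rw [signedRep_inv_eq_iff, hprod]
      exact signedRep_prod_tauB_zpow_of_lt i hk_le fun j' => by have := hk_le j'; omega
    -- A value above n would be fixed by `w`, yet `w` sends it to `k_j = n`.
    have hle : signedRep n w⁻¹ (k j) ≤ k j := by
      by_contra hgt
      have hv : signedRep n w (signedRep n w⁻¹ (k j)) = k j := signedRep_inv_eq_iff.1 rfl
      rw [hprod, signedRep_prod_tauB_zpow_of_lt i hk_le
        (fun j' => by have := hk_le j'; rw [← hprod]; omega), ← hprod] at hv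
      omega
    omega
  have hdes (r : ℕ) : r ∈ desB n w ↔ ∃ j, r = k j ∧ i j < 0 := by
    rw [mem_desB_iff hw]
    constructor
    · rintro ⟨h1, h2, h3⟩
      exact (key h1 h2.le).1 h3
    · rintro ⟨j, rfl, hj⟩
      exact ⟨hk_one j, hlt j hj, (key (hk_one j) (hk_le j)).2 ⟨j, rfl, hj⟩⟩
  refine ⟨fun j => ?_, Set.ext hdes⟩
  rw [hdes]
  constructor
  · rintro ⟨j', hj, hneg⟩
    rwa [hk_mono.injective hj]
  · exact fun h => ⟨j, rfl, h⟩
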